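/- Let $G$ be a finite group, $V$ a finite-dimensional complex representation of $G$, and $u\in G$ a central element with $u^2=1$ that acts on $V$ by $-1$. For a symmetric 2-tensor $B\in S^2V\subset V\otimes V$ let $A(G,V,u,B)$ be the following complex Hopf algebra. As an algebra it is the smash product $\mathbb{C}[G]\ltimes\Lambda V$, in which $gvg^{-1}=g\cdot v$ for $g\in G$, $v\in V$. Regard it as a superalgebra with $G$ even and $V$ odd, let $\Delta$ be the superalgebra homomorphism into its super tensor square with $\Delta(g)=g\otimes g$ and $\Delta(v)=v\otimes 1+1\otimes v$, put $J=e^{B}$ and $\Delta^J(x)=J^{-1}\Delta(x)J$, and for homogeneous $x$ of parity $p(x)$ write $\Delta^J(x)=\Delta_0(x)+\Delta_1(x)$, where the second tensor factors of $\Delta_0(x)$ and $\Delta_1(x)$ are even and odd, respectively. The coproduct of $A(G,V,u,B)$ is $$\widetilde{\Delta^J}(x)=\Delta_0(x)-(-1)^{p(x)}(u\otimes 1)\Delta_1(x),$$ and the counit is the algebra homomorphism $\varepsilon$ with $\varepsilon(g)=1$ and $\varepsilon(v)=0$. Let $A(G,V,u,B)^*$ be the dual algebra, i.e. the space of linear functionals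 on $A(G,V,u,B)$ with the convolution product $(\varphi\psi)(x)=(\varphi\otimes\psi)(\widetilde{\Delta^J}(x))$ and unit $\varepsilon$. Then, for fixed $G,V,u$, the algebras $A(G,V,u,B)^*$, $B\in S^2V$, fall into finitely many isomorphism classes of $\mathbb{C}$-algebras. -/

import Mathlib

open scoped TensorProduct

set_option linter.unusedSectionVars false

noncomputable section

namespace TriHopf

universe u v

/-! ### The group action on the exterior algebra -/

section Action

variable {G : Type u} {V : Type v} [Group G] [AddCommGroup V] [Module ℂ V]
  [DistribMulAction G V] [SMulCommClass G ℂ V]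

/-- `g ∈ G` acts on `Λ V` by the algebra automorphism extending `v ↦ g v`. -/
instance extAction : MulSemiringAction G (ExteriorAlgebra ℂ V) where
  smul g x := ExteriorAlgebra.map (DistribSMul.toLinearMap ℂ V g) x
  one_smul x := by
    have h : DistribSMul.toLinearMap ℂ V (1 : G) = LinearMap.id := by ext; simp
    change ExteriorAlgebra.map (DistribSMul.toLinearMap ℂ V (1 : G)) x = x
    rw [h, ExteriorAlgebra.map_id]; rfl
  mul_smul g h x := by
    have e : DistribSMul.toLinearMap ℂ V (g * h) =
        DistribSMul.toLinearMap ℂ V g ∘ₗ DistribSMul.toLinearMap ℂ V h := by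
      ext; simp [mul_smul]
    change ExteriorAlgebra.map (DistribSMul.toLinearMap ℂ V (g * h)) x =
      ExteriorAlgebra.map (DistribSMul.toLinearMap ℂ V g)
        (ExteriorAlgebra.map (DistribSMul.toLinearMap ℂ V h) x)
    rw [e, ← ExteriorAlgebra.map_comp_map]; rfl
  smul_zero g := map_zero (ExteriorAlgebra.map (DistribSMul.toLinearMap ℂ V g))
  smul_add g := map_add (ExteriorAlgebra.map (DistribSMul.toLinearMap ℂ V g))
  smul_one g := map_one (ExteriorAlgebra.map (DistribSMul.toLinearMap ℂ V g))
  smul_mul g := map_mul (ExteriorAlgebra.map (DistribSMul.toLinearMap ℂ V g))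

theorem smul_ext_def (g : G) (x : ExteriorAlgebra ℂ V) :
    g • x = ExteriorAlgebra.map (DistribSMul.toLinearMap ℂ V g) x := rfl

theorem smul_ι (g : G) (w : V) :
    g • ExteriorAlgebra.ι ℂ w = ExteriorAlgebra.ι ℂ (g • w) := by
  rw [smul_ext_def, ExteriorAlgebra.map_apply_ι]; rfl

instance extSMulComm : SMulCommClass G ℂ (ExteriorAlgebra ℂ V) where
  smul_comm g c x := map_smul (ExteriorAlgebra.map (DistribSMul.toLinearMap ℂ V g)) c x

/-- The `ℤ/2`-grading of `Λ V`. -/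
abbrev extParity (V : Type v) [AddCommGroup V] [Module ℂ V] :
    ZMod 2 → Submodule ℂ (ExteriorAlgebra ℂ V) :=
  CliffordAlgebra.evenOdd (0 : QuadraticForm ℂ V)

theorem smul_mem_extParity (g : G) {i : ZMod 2} {x : ExteriorAlgebra ℂ V}
    (hx : x ∈ extParity V i) : g • x ∈ extParity V i := by
  induction x, hx using CliffordAlgebra.evenOdd_induction with
  | range_ι_pow w h =>
    refine Submodule.mem_iSup_of_mem ⟨i.val, i.natCast_zmod_val⟩ ?_
    have hr : (LinearMap.range (CliffordAlgebra.ι (0 : QuadraticForm ℂ V))).map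
        (ExteriorAlgebra.map (DistribSMul.toLinearMap ℂ V g)).toLinearMap ≤
        LinearMap.range (CliffordAlgebra.ι (0 : QuadraticForm ℂ V)) := by
      rintro _ ⟨_, ⟨w, rfl⟩, rfl⟩
      exact ⟨g • w, (smul_ι g w).symm⟩
    have h2 := Submodule.mem_map_of_mem
      (f := (ExteriorAlgebra.map (DistribSMul.toLinearMap ℂ V g)).toLinearMap) h
    rw [Submodule.map_pow] at h2
    exact pow_le_pow_left' hr _ h2
  | add x y _ _ h₁ h₂ => rw [smul_add]; exact add_mem h₁ h₂
  | ι_mul_ι_mul a b x _ h =>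
    rw [smul_mul', smul_mul']
    have := SetLike.mul_mem_graded (A := extParity V)
      (CliffordAlgebra.ι_mul_ι_mem_evenOdd_zero (0 : QuadraticForm ℂ V) (g • a) (g • b)) h
    rw [zero_add] at this
    have ea : g • (CliffordAlgebra.ι (0 : QuadraticForm ℂ V) a) =
      CliffordAlgebra.ι (0 : QuadraticForm ℂ V) (g • a) := smul_ι g a
    have eb : g • (CliffordAlgebra.ι (0 : QuadraticForm ℂ V) b) =
      CliffordAlgebra.ι (0 : QuadraticForm ℂ V) (g • b) := smul_ι g b
    rw [ea, eb]; exact this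

end Action

/-! ### The Hopf superalgebra `ℂ[G ⋉ V]` -/

section Super

variable (G : Type u) (V : Type v) [Group G] [AddCommGroup V] [Module ℂ V]
  [DistribMulAction G V] [SMulCommClass G ℂ V]

/-- The group algebra `ℂ[G ⋉ V] = ℂ[G] ⋉ Λ V` of the supergroup `G ⋉ V`, i.e. the smash product,
in which `g * α * g⁻¹ = g • α` for `g ∈ G` and `α ∈ Λ V`; the element `α * g` is `single g α`. -/
abbrev SuperGroupAlgebra : Type (max u v) := SkewMonoidAlgebra (ExteriorAlgebra ℂ V) G

/-- The parity grading of `ℂ[G ⋉ V]`: elements of `G` are even, vectors are odd. -/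
def parity (i : ZMod 2) : Submodule ℂ (SuperGroupAlgebra G V) where
  carrier := {x | ∀ g, x.coeff g ∈ extParity V i}
  zero_mem' := fun g => by simp
  add_mem' := fun {x y} hx hy g => by
    simpa using add_mem (hx g) (hy g)
  smul_mem' := fun c x hx g => by
    simpa using Submodule.smul_mem _ c (hx g)

variable {G V} in
theorem mem_parity {i : ZMod 2} {x : SuperGroupAlgebra G V} :
    x ∈ parity G V i ↔ ∀ g, x.coeff g ∈ extParity V i := Iff.rfl

variable {G V} in
theorem single_mem_parity {i : ZMod 2} (g : G) {a : ExteriorAlgebra ℂ V}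
    (ha : a ∈ extParity V i) : SkewMonoidAlgebra.single g a ∈ parity G V i := by
  classical
  intro h
  rw [SkewMonoidAlgebra.coeff_single_apply]
  split_ifs
  · exact ha
  · exact zero_mem _

/-- The projection of `ℂ[G ⋉ V]` onto its part of parity `i`. -/
def parityProj (i : ZMod 2) : SuperGroupAlgebra G V →ₗ[ℂ] SuperGroupAlgebra G V where
  toFun x := ⟨x.coeff.mapRange (GradedAlgebra.proj (extParity V) i) (map_zero _)⟩
  map_add' x y := by ext g; simp
  map_smul' c x := by ext g; simp

theorem coeff_parityProj (i : ZMod 2) (x : SuperGroupAlgebra G V) (g : G) :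
    (parityProj G V i x).coeff g = GradedAlgebra.proj (extParity V) i (x.coeff g) := by
  simp [parityProj]

theorem parityProj_mem (i : ZMod 2) (x : SuperGroupAlgebra G V) :
    parityProj G V i x ∈ parity G V i := by
  intro g
  rw [coeff_parityProj, GradedAlgebra.proj_apply]
  exact SetLike.coe_mem _

theorem parityProj_of_mem {i j : ZMod 2} {x : SuperGroupAlgebra G V} (hx : x ∈ parity G V i) :
    parityProj G V j x = if i = j then x else 0 := by
  ext g
  rw [coeff_parityProj, GradedAlgebra.proj_apply]
  split_ifs with h
  · subst h
    exact DirectSum.decompose_of_mem_same _ (hx g)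
  · exact DirectSum.decompose_of_mem_ne _ (hx g) h

theorem parityProj_add (x : SuperGroupAlgebra G V) :
    parityProj G V 0 x + parityProj G V 1 x = x := by
  ext g
  rw [SkewMonoidAlgebra.coeff_add, Finsupp.add_apply, coeff_parityProj, coeff_parityProj]
  induction x.coeff g using DirectSum.Decomposition.inductionOn (extParity V) with
  | zero => simp
  | @homogeneous i m =>
    rw [GradedAlgebra.proj_apply, GradedAlgebra.proj_apply]
    rcases (by decide : ∀ i : ZMod 2, i = 0 ∨ i = 1) i with rfl | rfl
    · rw [DirectSum.decompose_of_mem_same _ m.2,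
        DirectSum.decompose_of_mem_ne _ m.2 (by decide), add_zero]
    · rw [DirectSum.decompose_of_mem_same _ m.2,
        DirectSum.decompose_of_mem_ne _ m.2 (by decide), zero_add]
  | add m n hm hn => rw [map_add, map_add, add_add_add_comm, hm, hn]

instance parity_gradedMonoid : SetLike.GradedMonoid (parity G V) where
  one_mem := single_mem_parity 1 SetLike.GradedOne.one_mem
  mul_mem i j x y hx hy := by
    rw [SkewMonoidAlgebra.mul_def, SkewMonoidAlgebra.sum_def', ]
    refine Submodule.sum_mem _ fun a _ => ?_
    rw [SkewMonoidAlgebra.sum_def']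
    refine Submodule.sum_mem _ fun b _ => ?_
    exact single_mem_parity _ (SetLike.mul_mem_graded (hx a) (smul_mem_extParity a (hy b)))

/-- The decomposition of an element of `ℂ[G ⋉ V]` into its even and odd parts. -/
def parityDecompose : SuperGroupAlgebra G V →ₗ[ℂ] DirectSum (ZMod 2) fun i => parity G V i :=
  ∑ i : ZMod 2, DirectSum.lof ℂ (ZMod 2) (fun i => parity G V i) i ∘ₗ
    (parityProj G V i).codRestrict (parity G V i) (parityProj_mem G V i)

theorem parityDecompose_of_mem (i : ZMod 2) (x : parity G V i) :
    parityDecompose G V x = DirectSum.lof ℂ (ZMod 2) (fun i => parity G V i) i x := by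
  rw [parityDecompose, LinearMap.sum_apply, Finset.sum_eq_single i]
  · rw [LinearMap.comp_apply]
    congr 1
    exact Subtype.ext (by simp [parityProj_of_mem G V x.2])
  · intro j _ hj
    have : (parityProj G V j).codRestrict (parity G V j) (parityProj_mem G V j) x = 0 :=
      Subtype.ext (by simp [parityProj_of_mem G V x.2, hj.symm])
    rw [LinearMap.comp_apply, this, map_zero]
  · simp

instance parity_gradedAlgebra : GradedAlgebra (parity G V) where
  decompose' := parityDecompose G V
  left_inv x := by
    rw [parityDecompose, LinearMap.sum_apply, map_sum]
    refine (Fin.sum_univ_two _).trans ?_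
    simp only [LinearMap.comp_apply]
    exact (congrArg₂ (· + ·) (DirectSum.coeAddMonoidHom_of _ _ _)
      (DirectSum.coeAddMonoidHom_of _ _ _)).trans (parityProj_add G V x)
  right_inv x := by
    induction x using DirectSum.induction_on with
    | zero => rw [map_zero, map_zero]
    | of i x => rw [DirectSum.coeAddMonoidHom_of]; exact parityDecompose_of_mem G V i x
    | add x y hx hy => rw [map_add, map_add, hx, hy]

/-- The tensor square of `ℂ[G ⋉ V]` as a superalgebra:
`(a ⊗ b) (c ⊗ d) = (-1) ^ (|b| |c|) ac ⊗ bd`. -/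
abbrev SuperTensor : Type (max u v) := parity G V ᵍ⊗[ℂ] parity G V

instance superTensorModuleRat : Module ℚ (SuperTensor G V) :=
  Module.compHom _ (algebraMap ℚ ℂ)

variable {G V}

/-- `v ∈ V` as an element of `ℂ[G ⋉ V]`. -/
def vec : V →ₗ[ℂ] SuperGroupAlgebra G V :=
  SkewMonoidAlgebra.lsingle ℂ 1 ∘ₗ ExteriorAlgebra.ι ℂ

/-- `g ∈ G` as an element of `ℂ[G ⋉ V]`. -/
def grp : G →* SuperGroupAlgebra G V := SkewMonoidAlgebra.of _ G

theorem vec_apply (w : V) :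
    (vec w : SuperGroupAlgebra G V) = SkewMonoidAlgebra.single 1 (ExteriorAlgebra.ι ℂ w) := rfl

theorem grp_apply (g : G) :
    (grp g : SuperGroupAlgebra G V) = SkewMonoidAlgebra.single g 1 := rfl

theorem vec_mem (w : V) : (vec w : SuperGroupAlgebra G V) ∈ parity G V 1 :=
  single_mem_parity 1 (CliffordAlgebra.ι_mem_evenOdd_one _ w)

theorem grp_mem (g : G) : (grp g : SuperGroupAlgebra G V) ∈ parity G V 0 :=
  single_mem_parity g SetLike.GradedOne.one_mem

theorem vec_mul_self (w : V) : (vec w : SuperGroupAlgebra G V) * vec w = 0 := by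
  rw [vec_apply, SkewMonoidAlgebra.single_mul_single, one_smul, ExteriorAlgebra.ι_sq_zero,
    SkewMonoidAlgebra.single_zero]

theorem vec_mul_vec (w w' : V) :
    (vec w : SuperGroupAlgebra G V) * vec w' = -(vec w' * vec w) := by
  have h := vec_mul_self (G := G) (w + w')
  rw [map_add, add_mul, mul_add, mul_add, vec_mul_self, vec_mul_self, zero_add, add_zero] at h
  exact eq_neg_of_add_eq_zero_left h

theorem grp_mul_vec (g : G) (w : V) :
    (grp g : SuperGroupAlgebra G V) * vec w = vec (g • w) * grp g := by
  rw [vec_apply, vec_apply, grp_apply, SkewMonoidAlgebra.single_mul_single,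
    SkewMonoidAlgebra.single_mul_single, one_smul, smul_ι]
  simp

/-- The product of `ℂ[G ⋉ V] ⊗ ℂ[G ⋉ V]` on homogeneous tensors. -/
theorem tmul_mul_tmul {i j : ZMod 2} (a : SuperGroupAlgebra G V) {b c : SuperGroupAlgebra G V}
    (d : SuperGroupAlgebra G V) (hb : b ∈ parity G V i) (hc : c ∈ parity G V j) :
    (a ᵍ⊗ₜ[ℂ] b * c ᵍ⊗ₜ[ℂ] d : SuperTensor G V) =
      (-1 : ℤˣ) ^ (i * j) • ((a * c) ᵍ⊗ₜ[ℂ] (b * d)) :=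
  GradedTensorProduct.tmul_coe_mul_coe_tmul _ _ a ⟨b, hb⟩ ⟨c, hc⟩ d

/-- The coproduct of `ℂ[G ⋉ V]` on `V`: `v ↦ v ⊗ 1 + 1 ⊗ v`. -/
def vecComul : V →ₗ[ℂ] SuperTensor G V :=
  (GradedTensorProduct.includeLeft (parity G V) (parity G V)).toLinearMap ∘ₗ vec +
    (GradedTensorProduct.includeRight (parity G V) (parity G V)).toLinearMap ∘ₗ vec

theorem vecComul_apply (w : V) :
    (vecComul w : SuperTensor G V) = vec w ᵍ⊗ₜ[ℂ] 1 + 1 ᵍ⊗ₜ[ℂ] vec w := rfl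

theorem vecComul_sq (w : V) : (vecComul w : SuperTensor G V) * vecComul w = 0 := by
  have h1 : (1 : SuperGroupAlgebra G V) ∈ parity G V 0 := SetLike.GradedOne.one_mem
  rw [vecComul_apply, add_mul, mul_add, mul_add, tmul_mul_tmul _ _ h1 (vec_mem w),
    tmul_mul_tmul _ _ h1 h1, tmul_mul_tmul _ _ (vec_mem w) (vec_mem w),
    tmul_mul_tmul _ _ (vec_mem w) h1]
  simp only [vec_mul_self, mul_one, one_mul, mul_zero, uzpow_zero, one_smul, uzpow_one,
    Units.neg_smul, GradedTensorProduct.tmul, TensorProduct.zero_tmul, TensorProduct.tmul_zero,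
    map_zero, zero_add, add_zero, add_neg_cancel]

/-- The coproduct of `ℂ[G ⋉ V]` on `G`: `g ↦ g ⊗ g`. -/
def grpComul : G →* SuperTensor G V where
  toFun g := grp g ᵍ⊗ₜ[ℂ] grp g
  map_one' := by rw [map_one]; rfl
  map_mul' g h := by rw [tmul_mul_tmul _ _ (grp_mem g) (grp_mem h)]; simp

theorem grpComul_apply (g : G) : (grpComul g : SuperTensor G V) = grp g ᵍ⊗ₜ[ℂ] grp g := rfl

theorem grpComul_mul_vecComul (g : G) (w : V) :
    (grpComul g : SuperTensor G V) * vecComul w = vecComul (g • w) * grpComul g := by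
  have h1 : (1 : SuperGroupAlgebra G V) ∈ parity G V 0 := SetLike.GradedOne.one_mem
  rw [vecComul_apply, vecComul_apply, grpComul_apply, mul_add, add_mul,
    tmul_mul_tmul _ _ (grp_mem g) (vec_mem w), tmul_mul_tmul _ _ (grp_mem g) h1,
    tmul_mul_tmul _ _ h1 (grp_mem g), tmul_mul_tmul _ _ (vec_mem _) (grp_mem g)]
  simp [grp_mul_vec]

/-- The coproduct of `ℂ[G ⋉ V]` on `Λ V`. -/
def extComul : ExteriorAlgebra ℂ V →ₐ[ℂ] SuperTensor G V :=
  ExteriorAlgebra.lift ℂ ⟨vecComul, vecComul_sq⟩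

theorem extComul_smul (g : G) (x : ExteriorAlgebra ℂ V) :
    (extComul (g • x) : SuperTensor G V) * grpComul g = grpComul g * extComul x := by
  induction x using ExteriorAlgebra.induction with
  | algebraMap r =>
    rw [smul_algebraMap, AlgHom.commutes, Algebra.commutes]
  | ι w =>
    rw [smul_ι]
    simp only [extComul, ExteriorAlgebra.lift_ι_apply]
    exact (grpComul_mul_vecComul g w).symm
  | mul a b ha hb =>
    rw [smul_mul', map_mul, map_mul, mul_assoc, hb, ← mul_assoc, ha, mul_assoc]
  | add a b ha hb => rw [smul_add, map_add, map_add, add_mul, mul_add, ha, hb]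

/-- The coproduct of the Hopf superalgebra `ℂ[G ⋉ V]`: the algebra map `Δ` with `Δ g = g ⊗ g`
for `g ∈ G` and `Δ v = v ⊗ 1 + 1 ⊗ v` for `v ∈ V`. -/
def superComul : SuperGroupAlgebra G V →ₐ[ℂ] SuperTensor G V :=
  SkewMonoidAlgebra.liftNCAlgHom extComul grpComul fun {x g} => extComul_smul g x

theorem superComul_grp (g : G) :
    superComul (grp g : SuperGroupAlgebra G V) = grp g ᵍ⊗ₜ[ℂ] grp g := by
  change SkewMonoidAlgebra.liftNC _ _ (SkewMonoidAlgebra.single g 1) = _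
  rw [SkewMonoidAlgebra.liftNC_single]
  simp [grpComul_apply]

theorem superComul_vec (w : V) :
    superComul (vec w : SuperGroupAlgebra G V) = vec w ᵍ⊗ₜ[ℂ] 1 + 1 ᵍ⊗ₜ[ℂ] vec w := by
  change SkewMonoidAlgebra.liftNC _ _ (SkewMonoidAlgebra.single 1 (ExteriorAlgebra.ι ℂ w)) = _
  rw [SkewMonoidAlgebra.liftNC_single, map_one, mul_one]
  simp [extComul, vecComul_apply]

theorem algebraMapInv_smul (g : G) (x : ExteriorAlgebra ℂ V) :
    ExteriorAlgebra.algebraMapInv (g • x) = ExteriorAlgebra.algebraMapInv x := by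
  have h : ExteriorAlgebra.algebraMapInv.comp
      (ExteriorAlgebra.map (DistribSMul.toLinearMap ℂ V g)) = ExteriorAlgebra.algebraMapInv := by
    ext w
    simp [ExteriorAlgebra.algebraMapInv]
  exact DFunLike.congr_fun h x

/-- The counit of `ℂ[G ⋉ V]`: the algebra map `ε` with `ε g = 1` for `g ∈ G` and
`ε v = 0` for `v ∈ V`. -/
def superCounit : SuperGroupAlgebra G V →ₐ[ℂ] ℂ :=
  SkewMonoidAlgebra.liftNCAlgHom ExteriorAlgebra.algebraMapInv (1 : G →* ℂ)
    fun {x g} => by simp [algebraMapInv_smul g x]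

/-! ### The twist `J = e ^ B` and the Hopf algebra `A(G, V, u, B)` -/

/-- A 2-tensor on `V` as an element of `ℂ[G ⋉ V] ⊗ ℂ[G ⋉ V]`. -/
def tensorToSuper : V ⊗[ℂ] V →ₗ[ℂ] SuperTensor G V :=
  (GradedTensorProduct.of ℂ (parity G V) (parity G V)).toLinearMap ∘ₗ TensorProduct.map vec vec

theorem tensorToSuper_tmul (w w' : V) :
    (tensorToSuper (w ⊗ₜ w') : SuperTensor G V) = vec w ᵍ⊗ₜ[ℂ] vec w' := rfl

theorem tensorToSuper_commute (s t : V ⊗[ℂ] V) :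
    Commute (tensorToSuper s : SuperTensor G V) (tensorToSuper t) := by
  induction s using TensorProduct.induction_on with
  | zero => rw [map_zero]; exact Commute.zero_left _
  | add s s' h h' => rw [map_add]; exact h.add_left h'
  | tmul a b =>
    induction t using TensorProduct.induction_on with
    | zero => rw [map_zero]; exact Commute.zero_right _
    | add t t' h h' => rw [map_add]; exact h.add_right h'
    | tmul c d =>
      change _ * _ = _ * _
      rw [tensorToSuper_tmul, tensorToSuper_tmul, tmul_mul_tmul _ _ (vec_mem b) (vec_mem c),
        tmul_mul_tmul _ _ (vec_mem d) (vec_mem a), vec_mul_vec a c, vec_mul_vec b d]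
      simp [TensorProduct.neg_tmul, TensorProduct.tmul_neg]

/-- The image of a 2-tensor is nilpotent, so that its exponential is a finite sum. -/
theorem tensorToSuper_isNilpotent (s : V ⊗[ℂ] V) :
    IsNilpotent (tensorToSuper s : SuperTensor G V) := by
  induction s using TensorProduct.induction_on with
  | zero => rw [map_zero]; exact IsNilpotent.zero
  | add s t h h' => rw [map_add]; exact (tensorToSuper_commute s t).isNilpotent_add h h'
  | tmul a b =>
    refine ⟨2, ?_⟩
    rw [pow_two, tensorToSuper_tmul, tmul_mul_tmul _ _ (vec_mem b) (vec_mem a), vec_mul_self]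
    simp

variable (V) in
/-- `S²V`, the space of symmetric 2-tensors on `V`. -/
def symTensors : Submodule ℂ (V ⊗[ℂ] V) :=
  LinearMap.eqLocus (TensorProduct.comm ℂ V V).toLinearMap LinearMap.id

variable (G) in
/-- The twist `J = e ^ B`. -/
def twist (B : symTensors V) : SuperTensor G V :=
  IsNilpotent.exp (tensorToSuper (B : V ⊗[ℂ] V))

variable (G) in
/-- The inverse `J⁻¹ = e ^ (-B)` of the twist. -/
def twistInv (B : symTensors V) : SuperTensor G V :=
  IsNilpotent.exp (-tensorToSuper (B : V ⊗[ℂ] V))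

theorem twist_mul_twistInv (B : symTensors V) : twist G B * twistInv G B = 1 :=
  IsNilpotent.exp_mul_exp_neg_self (tensorToSuper_isNilpotent _)

theorem twistInv_mul_twist (B : symTensors V) : twistInv G B * twist G B = 1 :=
  IsNilpotent.exp_neg_mul_exp_self (tensorToSuper_isNilpotent _)

/-- The coproduct `Δ^J x = J⁻¹ Δ(x) J` of the Hopf superalgebra `ℂ[G ⋉ V]^J`, `J = e ^ B`. -/
def twistedComul (B : symTensors V) : SuperGroupAlgebra G V →ₗ[ℂ] SuperTensor G V :=
  LinearMap.mulLeft ℂ (twistInv G B) ∘ₗ LinearMap.mulRight ℂ (twist G B) ∘ₗ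
    superComul.toLinearMap

theorem twistedComul_apply (B : symTensors V) (x : SuperGroupAlgebra G V) :
    twistedComul B x = twistInv G B * (superComul x * twist G B) := rfl

/-- The coproduct of `A(G, V, u, B)`: for `x` of parity `p`,
`x ↦ Δ₀ x - (-1) ^ p (u ⊗ 1) Δ₁ x`, where `Δ₀ x` and `Δ₁ x` are the components of `Δ^J x` whose
second tensor factor is even and odd, respectively. -/
def bosonComul (u : G) (B : symTensors V) :
    SuperGroupAlgebra G V →ₗ[ℂ] SuperGroupAlgebra G V ⊗[ℂ] SuperGroupAlgebra G V :=
  let D : SuperGroupAlgebra G V →ₗ[ℂ] SuperGroupAlgebra G V ⊗[ℂ] SuperGroupAlgebra G V :=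
    (GradedTensorProduct.of ℂ (parity G V) (parity G V)).symm.toLinearMap ∘ₗ twistedComul B
  TensorProduct.map LinearMap.id (parityProj G V 0) ∘ₗ D -
    TensorProduct.map (LinearMap.mulLeft ℂ (grp u)) (parityProj G V 1) ∘ₗ D ∘ₗ
      (parityProj G V 0 - parityProj G V 1)

variable (G V) in
/-- The underlying space of the triangular Hopf algebra `A(G, V, u, B)`. -/
def Hopf (_u : G) (_B : symTensors V) : Type (max u v) := SuperGroupAlgebra G V

variable (u : G) (B : symTensors V)

/-- `A(G, V, u, B)` has the multiplication of `ℂ[G ⋉ V]`. -/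
instance : Ring (Hopf G V u B) := inferInstanceAs (Ring (SuperGroupAlgebra G V))

instance : Algebra ℂ (Hopf G V u B) := inferInstanceAs (Algebra ℂ (SuperGroupAlgebra G V))

/-- The coproduct and the counit of `A(G, V, u, B)`. -/
instance : CoalgebraStruct ℂ (Hopf G V u B) where
  comul := bosonComul u B
  counit := superCounit.toLinearMap

variable (G V) in
/-- The dual algebra `A(G, V, u, B)^*`: linear functionals with the convolution product
`(φ ψ)(x) = ∑ φ(x₁) ψ(x₂)`; its unit is the counit of `A(G, V, u, B)`. -/
abbrev DualAlgebra (u : G) (B : symTensors V) : Type (max u v) :=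
  WithConv (Hopf G V u B →ₗ[ℂ] ℂ)

/-- The unit of `A(G, V, u, B)^*`. -/
def dualOne : DualAlgebra G V u B := WithConv.toConv Coalgebra.counit

/-- An isomorphism of algebras `A(G, V, u, B)^* ≅ A(G, V, u, B')^*`: a linear bijection that
preserves products and the unit. -/
def DualIso (u : G) (B B' : symTensors V) : Prop :=
  ∃ e : DualAlgebra G V u B ≃ₗ[ℂ] DualAlgebra G V u B',
    e (dualOne u B) = dualOne u B' ∧ ∀ φ ψ, e (φ * ψ) = e φ * e ψ

variable (V) in
/-- The parameters `B`, `B' ∈ S²V` are equivalent if `A(G, V, u, B)^*` and `A(G, V, u, B')^*` are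
isomorphic algebras. -/
def dualIsoSetoid (u : G) : Setoid (symTensors V) where
  r := DualIso u
  iseqv :=
    { refl := fun _ => ⟨LinearEquiv.refl _ _, rfl, fun _ _ => rfl⟩
      symm := fun ⟨e, h1, hm⟩ => ⟨e.symm, by rw [← h1, e.symm_apply_apply], fun φ ψ =>
        e.injective (by rw [hm]; simp only [LinearEquiv.apply_symm_apply])⟩
      trans := fun ⟨e, h1, hm⟩ ⟨f, k1, km⟩ => ⟨e.trans f, by
        rw [LinearEquiv.trans_apply, h1, k1], fun φ ψ => by
        simp only [LinearEquiv.trans_apply, hm, km]⟩ }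

end Super

end TriHopf

end

noncomputable section

namespace TriHopf

universe u v

/-! ### Exponentials of nilpotent elements. -/

section Exponential

variable {A : Type*} [Ring A] [Module ℚ A]

/-! The dual algebra depends only on the coalgebra, so coalgebra isomorphisms need not respect
multiplication. Moving `g ⊗ g` past `J` turns `B` into `g B`, and 2-tensors commute with `Δ(Λ V)`.
Hence on the block `Λ V * g` the twisted coproduct is `Δ(a) e^(g B - B) (g ⊗ g)`
(`twistedComul_single`): it sees `B` only through the symmetric tensor `g B - B`.

Therefore, if for each `g` some `T g` in `GL(V)` carries `g B - B` to `g B' - B'`, applying `Λ(T g)`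
on the block of `g` intertwines the twisted coproducts (`blockTensorMap_twistedComul`). The factor
`u` in the final coproduct links the blocks of `g` and `u g`, so `T (u g) = T g` is also needed.
This can be arranged: `u` acts trivially on `V ⊗ V`, so both blocks have the same tensor.

Over `ℂ`, symmetric tensors form finitely many `GL(V)`-orbits
(`exists_finite_congruence_invariant`). Recording an orbit label for each `g` in the finite group
`G` gives a finite invariant that determines the dual algebra up to isomorphism. -/

theorem exists_pow_eq_zero_of_isNilpotent {a b : A} (ha : IsNilpotent a) (hb : IsNilpotent b) :
    ∃ k, a ^ k = 0 ∧ b ^ k = 0 := by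
  obtain ⟨m, hm⟩ := ha
  obtain ⟨n, hn⟩ := hb
  exact ⟨max m n, pow_eq_zero_of_le (le_max_left _ _) hm, pow_eq_zero_of_le (le_max_right _ _) hn⟩

theorem semiconjBy_exp {x a b : A} (h : SemiconjBy x a b) (ha : IsNilpotent a)
    (hb : IsNilpotent b) : SemiconjBy x (IsNilpotent.exp a) (IsNilpotent.exp b) := by
  obtain ⟨k, hak, hbk⟩ := exists_pow_eq_zero_of_isNilpotent ha hb
  rw [IsNilpotent.exp_eq_sum hak, IsNilpotent.exp_eq_sum hbk, SemiconjBy, Finset.mul_sum,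
    Finset.sum_mul]
  refine Finset.sum_congr rfl fun i _ => ?_
  -- `A` is not assumed to be a `ℚ`-algebra. Rational scalars still pass through multiplication by
  -- `x`, since additive maps are automatically `ℚ`-linear.
  have h1 := map_rat_smul (AddMonoidHom.mulLeft x) (i.factorial⁻¹ : ℚ) (a ^ i)
  have h2 := map_rat_smul (AddMonoidHom.mulRight x) (i.factorial⁻¹ : ℚ) (b ^ i)
  simp only [AddMonoidHom.coe_mulLeft, AddMonoidHom.mulRight_apply] at h1 h2
  rw [h1, h2, (h.pow_right i).eq]

end Exponential

/-! ### Functoriality of the parity grading -/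

section Parity

variable {V : Type v} [AddCommGroup V] [Module ℂ V]

theorem map_mem_extParity (T : V →ₗ[ℂ] V) {i : ZMod 2} {x : ExteriorAlgebra ℂ V}
    (hx : x ∈ extParity V i) : ExteriorAlgebra.map T x ∈ extParity V i := by
  induction x, hx using CliffordAlgebra.evenOdd_induction with
  | range_ι_pow w h =>
    refine Submodule.mem_iSup_of_mem ⟨i.val, i.natCast_zmod_val⟩ ?_
    have hr : (LinearMap.range (CliffordAlgebra.ι (0 : QuadraticForm ℂ V))).map
        (ExteriorAlgebra.map T).toLinearMap ≤
        LinearMap.range (CliffordAlgebra.ι (0 : QuadraticForm ℂ V)) := by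
      rintro _ ⟨_, ⟨w, rfl⟩, rfl⟩
      exact ⟨T w, (ExteriorAlgebra.map_apply_ι T w).symm⟩
    have h2 := Submodule.mem_map_of_mem (f := (ExteriorAlgebra.map T).toLinearMap) h
    rw [Submodule.map_pow] at h2
    exact pow_le_pow_left' hr _ h2
  | add x y _ _ h₁ h₂ => rw [map_add]; exact add_mem h₁ h₂
  | ι_mul_ι_mul a b x _ h =>
    rw [map_mul, map_mul]
    have := SetLike.mul_mem_graded (A := extParity V)
      (CliffordAlgebra.ι_mul_ι_mem_evenOdd_zero (0 : QuadraticForm ℂ V) (T a) (T b)) h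
    rw [zero_add] at this
    have ea (c : V) : ExteriorAlgebra.map T (CliffordAlgebra.ι (0 : QuadraticForm ℂ V) c) =
      CliffordAlgebra.ι (0 : QuadraticForm ℂ V) (T c) := ExteriorAlgebra.map_apply_ι T c
    rw [ea, ea]; exact this

theorem extParity_proj_map (T : V →ₗ[ℂ] V) (i : ZMod 2) (x : ExteriorAlgebra ℂ V) :
    GradedAlgebra.proj (extParity V) i (ExteriorAlgebra.map T x) =
      ExteriorAlgebra.map T (GradedAlgebra.proj (extParity V) i x) := by
  induction x using DirectSum.Decomposition.inductionOn (extParity V) with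
  | zero => simp
  | @homogeneous j m =>
    rw [GradedAlgebra.proj_apply, GradedAlgebra.proj_apply]
    by_cases h : j = i
    · subst h
      rw [DirectSum.decompose_of_mem_same _ m.2,
        DirectSum.decompose_of_mem_same _ (map_mem_extParity T m.2)]
    · rw [DirectSum.decompose_of_mem_ne _ m.2 h,
        DirectSum.decompose_of_mem_ne _ (map_mem_extParity T m.2) h, map_zero]
  | add m n hm hn => simp only [map_add, hm, hn]

/-- The linear automorphism of `Λ V` induced by one of `V`. -/
def extMapEquiv (T : V ≃ₗ[ℂ] V) : ExteriorAlgebra ℂ V ≃ₗ[ℂ] ExteriorAlgebra ℂ V :=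
  LinearEquiv.ofLinearMap (ExteriorAlgebra.map T.toLinearMap).toLinearMap
    (ExteriorAlgebra.map T.symm.toLinearMap).toLinearMap
    (by rw [← AlgHom.comp_toLinearMap, ExteriorAlgebra.map_comp_map]; simp)
    (by rw [← AlgHom.comp_toLinearMap, ExteriorAlgebra.map_comp_map]; simp)

theorem algebraMapInv_map (T : V →ₗ[ℂ] V) (x : ExteriorAlgebra ℂ V) :
    ExteriorAlgebra.algebraMapInv (ExteriorAlgebra.map T x) = ExteriorAlgebra.algebraMapInv x := by
  have h : ExteriorAlgebra.algebraMapInv.comp (ExteriorAlgebra.map T) =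
      ExteriorAlgebra.algebraMapInv := by
    ext w
    simp [ExteriorAlgebra.algebraMapInv]
  exact DFunLike.congr_fun h x

end Parity

/-! ### Blockwise changes of coordinates -/

section BlockMap

variable {G : Type u} {V : Type v} [Group G] [Finite G] [AddCommGroup V] [Module ℂ V]

/-- The linear automorphism `α * g ↦ Λ(T g) α * g` of `ℂ[G ⋉ V]`. -/
def blockMap (T : G → V ≃ₗ[ℂ] V) : SuperGroupAlgebra G V ≃ₗ[ℂ] SuperGroupAlgebra G V :=
  let e : SuperGroupAlgebra G V ≃ₗ[ℂ] (G → ExteriorAlgebra ℂ V) :=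
    SkewMonoidAlgebra.coeffLinearEquiv ≪≫ₗ
      Finsupp.linearEquivFunOnFinite ℂ (ExteriorAlgebra ℂ V) G
  e ≪≫ₗ LinearEquiv.piCongrRight (fun g => extMapEquiv (T g)) ≪≫ₗ e.symm

theorem coeff_blockMap (T : G → V ≃ₗ[ℂ] V) (x : SuperGroupAlgebra G V) (g : G) :
    (blockMap T x).coeff g = ExteriorAlgebra.map (T g).toLinearMap (x.coeff g) := rfl

theorem blockMap_single (T : G → V ≃ₗ[ℂ] V) (g : G) (a : ExteriorAlgebra ℂ V) :
    blockMap T (SkewMonoidAlgebra.single g a) =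
      SkewMonoidAlgebra.single g (ExteriorAlgebra.map (T g).toLinearMap a) := by
  classical
  ext h
  rw [coeff_blockMap, SkewMonoidAlgebra.coeff_single_apply, SkewMonoidAlgebra.coeff_single_apply]
  split_ifs with hh
  · rw [hh]
  · rw [map_zero]

variable [DistribMulAction G V] [SMulCommClass G ℂ V]

theorem parityProj_blockMap (T : G → V ≃ₗ[ℂ] V) (i : ZMod 2) (x : SuperGroupAlgebra G V) :
    parityProj G V i (blockMap T x) = blockMap T (parityProj G V i x) := by
  ext g
  rw [coeff_parityProj, coeff_blockMap, coeff_blockMap, coeff_parityProj, extParity_proj_map]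

theorem superCounit_single (g : G) (a : ExteriorAlgebra ℂ V) :
    superCounit (SkewMonoidAlgebra.single g a : SuperGroupAlgebra G V) =
      ExteriorAlgebra.algebraMapInv a := by
  change SkewMonoidAlgebra.liftNC _ _ (SkewMonoidAlgebra.single g a) = _
  rw [SkewMonoidAlgebra.liftNC_single]
  simp

theorem superCounit_blockMap (T : G → V ≃ₗ[ℂ] V) (x : SuperGroupAlgebra G V) :
    superCounit (blockMap T x) = superCounit x := by
  induction x using SkewMonoidAlgebra.induction_on with
  | zero => simp
  | single g a => rw [blockMap_single, superCounit_single, superCounit_single, algebraMapInv_map]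
  | add x y hx hy => rw [map_add, map_add, map_add, hx, hy]

/-- Left multiplication by `u` moves block `g` to block `u g` and acts on the coefficients by
`Λ(-1)`, which commutes with every `Λ(T g)`. -/
theorem blockMap_grp_mul {u : G} (hu : ∀ w : V, u • w = -w) {T : G → V ≃ₗ[ℂ] V}
    (hT : ∀ g, T (u * g) = T g) (x : SuperGroupAlgebra G V) :
    blockMap T (grp u * x) = grp u * blockMap T x := by
  induction x using SkewMonoidAlgebra.induction_on with
  | zero => simp
  | single g a =>
    rw [blockMap_single, grp_apply, SkewMonoidAlgebra.single_mul_single,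
      SkewMonoidAlgebra.single_mul_single, blockMap_single, hT, one_mul, one_mul, smul_ext_def,
      smul_ext_def, ← AlgHom.comp_apply, ← AlgHom.comp_apply, ExteriorAlgebra.map_comp_map,
      ExteriorAlgebra.map_comp_map]
    congr 3
    ext w
    simp [hu]
  | add x y hx hy => rw [mul_add, map_add, map_add, hx, hy, mul_add]

end BlockMap

/-! ### The twisted coproduct on a block `Λ V * g` -/

section TwistedComul

variable {G : Type u} {V : Type v} [Group G] [AddCommGroup V] [Module ℂ V]
  [DistribMulAction G V] [SMulCommClass G ℂ V]

/-- The diagonal action of `g` on `V ⊗ V`. -/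
def tensorAct (g : G) : V ⊗[ℂ] V →ₗ[ℂ] V ⊗[ℂ] V :=
  TensorProduct.map (DistribSMul.toLinearMap ℂ V g) (DistribSMul.toLinearMap ℂ V g)

/-- The tensor `g B - B`. -/
def tensorDefect (g : G) (B : V ⊗[ℂ] V) : V ⊗[ℂ] V := tensorAct g B - B

theorem grpComul_semiconjBy (g : G) (s : V ⊗[ℂ] V) :
    SemiconjBy (grpComul g : SuperTensor G V) (tensorToSuper s)
      (tensorToSuper (tensorAct g s)) := by
  induction s using TensorProduct.induction_on with
  | zero => simp [SemiconjBy.zero_right]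
  | add s t hs ht => rw [map_add, map_add, map_add]; exact hs.add_right ht
  | tmul a b =>
    rw [tensorAct, TensorProduct.map_tmul, tensorToSuper_tmul, tensorToSuper_tmul, grpComul_apply,
      SemiconjBy, tmul_mul_tmul _ _ (grp_mem g) (vec_mem a),
      tmul_mul_tmul _ _ (vec_mem _) (grp_mem g), grp_mul_vec, grp_mul_vec]
    simp

/-- The vectors in the two tensor factors generate an exterior algebra on two copies of `V`, where
elements of degree two are central: the two sign changes cancel. -/
theorem tensorToSuper_commute_vecComul (s : V ⊗[ℂ] V) (w : V) :
    Commute (tensorToSuper s : SuperTensor G V) (vecComul w) := by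
  have h1 : (1 : SuperGroupAlgebra G V) ∈ parity G V 0 := SetLike.GradedOne.one_mem
  induction s using TensorProduct.induction_on with
  | zero => rw [map_zero]; exact Commute.zero_left _
  | add s t hs ht => rw [map_add]; exact hs.add_left ht
  | tmul a b =>
    change _ * _ = _ * _
    rw [tensorToSuper_tmul, vecComul_apply, mul_add, add_mul,
      tmul_mul_tmul _ _ (vec_mem b) (vec_mem w), tmul_mul_tmul _ _ (vec_mem b) h1,
      tmul_mul_tmul _ _ h1 (vec_mem a), tmul_mul_tmul _ _ (vec_mem w) (vec_mem a),
      vec_mul_vec w a, vec_mul_vec w b]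
    simp [GradedTensorProduct.tmul, TensorProduct.neg_tmul, TensorProduct.tmul_neg]

theorem tensorToSuper_commute_extComul (s : V ⊗[ℂ] V) (a : ExteriorAlgebra ℂ V) :
    Commute (tensorToSuper s : SuperTensor G V) (extComul a) := by
  induction a using ExteriorAlgebra.induction with
  | algebraMap r => rw [AlgHom.commutes]; exact Algebra.commute_algebraMap_right _ _
  | ι w =>
    simp only [extComul, ExteriorAlgebra.lift_ι_apply]
    exact tensorToSuper_commute_vecComul s w
  | mul a b ha hb => rw [map_mul]; exact ha.mul_right hb
  | add a b ha hb => rw [map_add]; exact ha.add_right hb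

theorem superComul_single (g : G) (a : ExteriorAlgebra ℂ V) :
    superComul (SkewMonoidAlgebra.single g a : SuperGroupAlgebra G V) =
      extComul a * grpComul g := by
  change SkewMonoidAlgebra.liftNC _ _ (SkewMonoidAlgebra.single g a) = _
  rw [SkewMonoidAlgebra.liftNC_single]
  rfl

/-- The key formula: the twist enters each block only through `g B - B`, because `e^(-B)` slides
past `Δ(a)` to meet the `e^(g B)` created when `J` crosses `g ⊗ g`. -/
theorem twistedComul_single (B : symTensors V) (g : G) (a : ExteriorAlgebra ℂ V) :
    twistedComul B (SkewMonoidAlgebra.single g a : SuperGroupAlgebra G V) =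
      extComul a * (IsNilpotent.exp (tensorToSuper (tensorDefect g (B : V ⊗[ℂ] V))) *
        grpComul g) := by
  have hn (s : V ⊗[ℂ] V) := tensorToSuper_isNilpotent (G := G) s
  have h1 := (semiconjBy_exp (grpComul_semiconjBy g (B : V ⊗[ℂ] V)) (hn _) (hn _)).eq
  have h2 : Commute (extComul a : SuperTensor G V) (twistInv G B) :=
    semiconjBy_exp ((tensorToSuper_commute_extComul (B : V ⊗[ℂ] V) a).symm.neg_right)
      (hn _).neg (hn _).neg
  have h3 : IsNilpotent.exp (tensorToSuper (G := G) (tensorDefect g (B : V ⊗[ℂ] V))) =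
      twistInv G B * IsNilpotent.exp (tensorToSuper (tensorAct g (B : V ⊗[ℂ] V))) := by
    rw [twistInv, ← IsNilpotent.exp_add_of_commute (tensorToSuper_commute _ _).neg_left
      (hn _).neg (hn _), tensorDefect, map_sub, sub_eq_neg_add]
  rw [twistedComul_apply, superComul_single, mul_assoc, twist, h1, h3, ← mul_assoc, ← h2.eq,
    mul_assoc, mul_assoc]

end TwistedComul

/-! ### Blockwise changes of coordinates and the twisted coproduct -/

section Intertwiners

variable {G : Type u} {V : Type v} [Group G] [Finite G] [AddCommGroup V] [Module ℂ V]
  [DistribMulAction G V] [SMulCommClass G ℂ V]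

/-- The tensor square of `blockMap T`. -/
def blockTensorMap (T : G → V ≃ₗ[ℂ] V) : SuperTensor G V →ₗ[ℂ] SuperTensor G V :=
  (GradedTensorProduct.of ℂ (parity G V) (parity G V)).toLinearMap ∘ₗ
    TensorProduct.map (blockMap T).toLinearMap (blockMap T).toLinearMap ∘ₗ
      (GradedTensorProduct.of ℂ (parity G V) (parity G V)).symm.toLinearMap

theorem blockTensorMap_tmul (T : G → V ≃ₗ[ℂ] V) (x y : SuperGroupAlgebra G V) :
    blockTensorMap T (x ᵍ⊗ₜ[ℂ] y : SuperTensor G V) = blockMap T x ᵍ⊗ₜ[ℂ] blockMap T y := rfl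

variable (V) in
/-- The subspace `Λ V * g ⊗ Λ V * g` of the tensor square. -/
def tensorBlock (g : G) : Submodule ℂ (SuperTensor G V) :=
  Submodule.span ℂ {z | ∃ i : ZMod 2, ∃ a ∈ extParity V i, ∃ b : ExteriorAlgebra ℂ V,
    z = SkewMonoidAlgebra.single g a ᵍ⊗ₜ[ℂ] SkewMonoidAlgebra.single g b}

theorem grpComul_mem_tensorBlock (g : G) : (grpComul g : SuperTensor G V) ∈ tensorBlock V g :=
  Submodule.subset_span ⟨0, 1, SetLike.GradedOne.one_mem, 1, rfl⟩

/-- On `Λ V * g ⊗ Λ V * g`, the map `blockTensorMap T` intertwines left multiplication by `z` with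
left multiplication by `z'`. -/
def Intertwines (T : G → V ≃ₗ[ℂ] V) (g : G) (z z' : SuperTensor G V) : Prop :=
  ∀ y ∈ tensorBlock V g, z * y ∈ tensorBlock V g ∧
    blockTensorMap T (z * y) = z' * blockTensorMap T y

namespace Intertwines

variable {T : G → V ≃ₗ[ℂ] V} {g : G} {a a' b b' : SuperTensor G V}

theorem add (h : Intertwines T g a a') (h' : Intertwines T g b b') :
    Intertwines T g (a + b) (a' + b') := fun y hy => by
  rw [add_mul, add_mul, map_add, (h y hy).2, (h' y hy).2]
  exact ⟨add_mem (h y hy).1 (h' y hy).1, rfl⟩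

/-- Stability of the block, the first half of `Intertwines`, is what allows the two intertwining
relations to be chained. -/
theorem mul (h : Intertwines T g a a') (h' : Intertwines T g b b') :
    Intertwines T g (a * b) (a' * b') := fun y hy => by
  rw [mul_assoc, mul_assoc, (h _ (h' y hy).1).2, (h' y hy).2]
  exact ⟨(h _ (h' y hy).1).1, rfl⟩

theorem smul (c : ℂ) (h : Intertwines T g a a') : Intertwines T g (c • a) (c • a') :=
  fun y hy => by
  rw [smul_mul_assoc, smul_mul_assoc, map_smul, (h y hy).2]
  exact ⟨Submodule.smul_mem _ _ (h y hy).1, rfl⟩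

variable (T g) in
theorem zero : Intertwines T g 0 0 := fun y _ => by
  rw [zero_mul, zero_mul, map_zero]
  exact ⟨zero_mem _, rfl⟩

variable (T g) in
theorem one : Intertwines T g 1 1 := fun y hy => by
  rw [one_mul, one_mul]
  exact ⟨hy, rfl⟩

theorem pow (h : Intertwines T g a a') (n : ℕ) : Intertwines T g (a ^ n) (a' ^ n) := by
  induction n with
  | zero => rw [pow_zero, pow_zero]; exact one T g
  | succ n ih => rw [pow_succ, pow_succ]; exact ih.mul h

theorem exp (ha : IsNilpotent a) (ha' : IsNilpotent a') (h : Intertwines T g a a') :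
    Intertwines T g (IsNilpotent.exp a) (IsNilpotent.exp a') := by
  obtain ⟨k, hk, hk'⟩ := exists_pow_eq_zero_of_isNilpotent ha ha'
  rw [IsNilpotent.exp_eq_sum hk, IsNilpotent.exp_eq_sum hk']
  -- With a common cutoff fixed, the vanishing of powers is no longer needed; the induction treats
  -- arbitrary partial sums.
  clear hk hk'
  induction k with
  | zero => rw [Finset.sum_range_zero, Finset.sum_range_zero]; exact zero T g
  | succ k ih =>
    rw [Finset.sum_range_succ, Finset.sum_range_succ]
    -- The `ℚ`-action on the tensor square is defined through `ℂ`, so the rational coefficient is a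
    -- complex scalar.
    exact ih.add ((h.pow k).smul (algebraMap ℚ ℂ (k.factorial⁻¹ : ℚ)))

end Intertwines

/-- By linearity it suffices to test generators of the block, whose left factor is homogeneous so
that the sign rule applies. -/
theorem intertwines_of_forall {T : G → V ≃ₗ[ℂ] V} {g : G} {z z' : SuperTensor G V}
    (h : ∀ (i : ZMod 2) (a b : ExteriorAlgebra ℂ V), a ∈ extParity V i →
      z * (SkewMonoidAlgebra.single g a ᵍ⊗ₜ[ℂ] SkewMonoidAlgebra.single g b) ∈ tensorBlock V g ∧
      blockTensorMap T
          (z * (SkewMonoidAlgebra.single g a ᵍ⊗ₜ[ℂ] SkewMonoidAlgebra.single g b)) =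
        z' * (blockMap T (SkewMonoidAlgebra.single g a) ᵍ⊗ₜ[ℂ]
          blockMap T (SkewMonoidAlgebra.single g b))) :
    Intertwines T g z z' := by
  intro y hy
  induction hy using Submodule.span_induction with
  | mem y hy =>
    obtain ⟨i, a, ha, b, rfl⟩ := hy
    exact h i a b ha
  | zero => simp
  | add x y _ _ hx hy =>
    simp only [mul_add, map_add]
    exact ⟨add_mem hx.1 hy.1, by rw [hx.2, hy.2]⟩
  | smul c x _ hx =>
    simp only [mul_smul_comm, map_smul]
    exact ⟨Submodule.smul_mem _ _ hx.1, by rw [hx.2]⟩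

theorem vec_mul_single (w : V) (g : G) (a : ExteriorAlgebra ℂ V) :
    vec w * (SkewMonoidAlgebra.single g a : SuperGroupAlgebra G V) =
      SkewMonoidAlgebra.single g (ExteriorAlgebra.ι ℂ w * a) := by
  rw [vec_apply, SkewMonoidAlgebra.single_mul_single, one_smul, one_mul]

theorem blockMap_vec_mul_single (T : G → V ≃ₗ[ℂ] V) (w : V) (g : G) (a : ExteriorAlgebra ℂ V) :
    blockMap T (vec w * SkewMonoidAlgebra.single g a) =
      vec (T g w) * blockMap T (SkewMonoidAlgebra.single g a) := by
  rw [vec_mul_single, blockMap_single, blockMap_single, vec_mul_single, map_mul,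
    ExteriorAlgebra.map_apply_ι]
  rfl

theorem vec_tmul_one_intertwines (T : G → V ≃ₗ[ℂ] V) (g : G) (w : V) :
    Intertwines T g (vec w ᵍ⊗ₜ[ℂ] 1) (vec (T g w) ᵍ⊗ₜ[ℂ] 1) := by
  have h1 : (1 : SuperGroupAlgebra G V) ∈ parity G V 0 := SetLike.GradedOne.one_mem
  refine intertwines_of_forall fun i a b ha => ?_
  have ha' : blockMap T (SkewMonoidAlgebra.single g a) ∈ parity G V i := by
    rw [blockMap_single]; exact single_mem_parity g (map_mem_extParity _ ha)
  rw [tmul_mul_tmul _ _ h1 (single_mem_parity g ha), tmul_mul_tmul _ _ h1 ha', one_mul, one_mul,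
    zero_mul, uzpow_zero, one_smul, one_smul, blockTensorMap_tmul, blockMap_vec_mul_single]
  refine ⟨?_, rfl⟩
  rw [vec_mul_single]
  exact Submodule.subset_span ⟨1 + i, _, SetLike.mul_mem_graded (A := extParity V)
    (CliffordAlgebra.ι_mem_evenOdd_one _ w) ha, b, rfl⟩

theorem one_tmul_vec_intertwines (T : G → V ≃ₗ[ℂ] V) (g : G) (w : V) :
    Intertwines T g (1 ᵍ⊗ₜ[ℂ] vec w) (1 ᵍ⊗ₜ[ℂ] vec (T g w)) := by
  refine intertwines_of_forall fun i a b ha => ?_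
  have ha' : blockMap T (SkewMonoidAlgebra.single g a) ∈ parity G V i := by
    rw [blockMap_single]; exact single_mem_parity g (map_mem_extParity _ ha)
  rw [tmul_mul_tmul _ _ (vec_mem w) (single_mem_parity g ha),
    tmul_mul_tmul _ _ (vec_mem _) ha', one_mul, one_mul, one_mul]
  have hmem : (SkewMonoidAlgebra.single g a ᵍ⊗ₜ[ℂ] (vec w * SkewMonoidAlgebra.single g b) :
      SuperTensor G V) ∈ tensorBlock V g := by
    rw [vec_mul_single]
    exact Submodule.subset_span ⟨i, a, ha, _, rfl⟩
  have hmap : blockTensorMap T (SkewMonoidAlgebra.single g a ᵍ⊗ₜ[ℂ]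
      (vec w * SkewMonoidAlgebra.single g b) : SuperTensor G V) =
      blockMap T (SkewMonoidAlgebra.single g a) ᵍ⊗ₜ[ℂ]
        (vec (T g w) * blockMap T (SkewMonoidAlgebra.single g b)) := by
    rw [blockTensorMap_tmul, blockMap_vec_mul_single]
  -- Since `blockMap T` preserves parity, the same sign arises on both sides from moving the vector
  -- past the left factor.
  rcases Int.units_eq_one_or ((-1 : ℤˣ) ^ i) with h | h
  · rw [h, one_smul, one_smul]
    exact ⟨hmem, hmap⟩
  · rw [h, Units.neg_smul, Units.neg_smul, one_smul, one_smul, map_neg, hmap]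
    exact ⟨neg_mem hmem, rfl⟩

theorem extComul_ι (w : V) :
    (extComul (ExteriorAlgebra.ι ℂ w) : SuperTensor G V) = vec w ᵍ⊗ₜ[ℂ] 1 + 1 ᵍ⊗ₜ[ℂ] vec w := by
  rw [extComul, ExteriorAlgebra.lift_ι_apply, vecComul_apply]

/-- Intertwining pairs are closed under sums and products, and both sides are multiplicative in `a`,
so only vectors have to be checked. -/
theorem extComul_intertwines (T : G → V ≃ₗ[ℂ] V) (g : G) (a : ExteriorAlgebra ℂ V) :
    Intertwines T g (extComul a) (extComul (ExteriorAlgebra.map (T g).toLinearMap a)) := by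
  induction a using ExteriorAlgebra.induction with
  | algebraMap r =>
    rw [AlgHom.commutes, AlgHom.commutes, AlgHom.commutes, Algebra.algebraMap_eq_smul_one]
    exact (Intertwines.one T g).smul r
  | ι w =>
    rw [ExteriorAlgebra.map_apply_ι, extComul_ι, extComul_ι]
    exact (vec_tmul_one_intertwines T g w).add (one_tmul_vec_intertwines T g w)
  | mul a b ha hb => rw [map_mul, map_mul, map_mul]; exact ha.mul hb
  | add a b ha hb => rw [map_add, map_add, map_add]; exact ha.add hb

theorem tensorToSuper_intertwines (T : G → V ≃ₗ[ℂ] V) (g : G) (s : V ⊗[ℂ] V) :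
    Intertwines T g (tensorToSuper s)
      (tensorToSuper (TensorProduct.map (T g).toLinearMap (T g).toLinearMap s)) := by
  have h1 : (1 : SuperGroupAlgebra G V) ∈ parity G V 0 := SetLike.GradedOne.one_mem
  induction s using TensorProduct.induction_on with
  | zero => simp only [map_zero]; exact Intertwines.zero T g
  | add s t hs ht => simp only [map_add]; exact hs.add ht
  | tmul a b =>
    have h (x y : V) : (vec x ᵍ⊗ₜ[ℂ] vec y : SuperTensor G V) =
        (vec x ᵍ⊗ₜ[ℂ] 1) * (1 ᵍ⊗ₜ[ℂ] vec y) := by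
      rw [tmul_mul_tmul _ _ h1 h1]; simp
    rw [TensorProduct.map_tmul, tensorToSuper_tmul, tensorToSuper_tmul, h, h]
    exact (vec_tmul_one_intertwines T g a).mul (one_tmul_vec_intertwines T g b)

/-- In the formula `Δ(a) e^(g B - B) (g ⊗ g)`, each of the first two factors is intertwined with its
counterpart for `B'`, and `g ⊗ g` is fixed. -/
theorem blockTensorMap_twistedComul {T : G → V ≃ₗ[ℂ] V} {B B' : symTensors V}
    (hT : ∀ g, TensorProduct.map (T g).toLinearMap (T g).toLinearMap
      (tensorDefect g (B : V ⊗[ℂ] V)) = tensorDefect g (B' : V ⊗[ℂ] V))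
    (x : SuperGroupAlgebra G V) :
    blockTensorMap T (twistedComul B x) = twistedComul B' (blockMap T x) := by
  induction x using SkewMonoidAlgebra.induction_on with
  | zero => simp
  | add x y hx hy => simp only [map_add, hx, hy]
  | single g a =>
    have h1 := extComul_intertwines T g a
    have h2 := (tensorToSuper_intertwines T g (tensorDefect g (B : V ⊗[ℂ] V))).exp
      (tensorToSuper_isNilpotent _) (tensorToSuper_isNilpotent _)
    have h3 : blockTensorMap T (grpComul g : SuperTensor G V) = grpComul g := by
      rw [grpComul_apply, blockTensorMap_tmul, grp_apply, blockMap_single, map_one]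
    obtain ⟨h4, h5⟩ := h2 _ (grpComul_mem_tensorBlock g)
    rw [blockMap_single, twistedComul_single, twistedComul_single, (h1 _ h4).2, h5, h3, hT]

/-- The shape of `bosonComul`: `P` and `Q` are the operators for the even and odd second factor (`Q`
including multiplication by `u`), and `S` is the sign `(-1) ^ p`. -/
theorem comp_sub_comp_comp_eq {R M N : Type*} [CommRing R] [AddCommGroup M] [AddCommGroup N]
    [Module R M] [Module R N] {F P Q : N →ₗ[R] N} {D D' : M →ₗ[R] N} {E S : M →ₗ[R] M}
    (hP : F ∘ₗ P = P ∘ₗ F) (hQ : F ∘ₗ Q = Q ∘ₗ F) (hD : F ∘ₗ D = D' ∘ₗ E)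
    (hS : E ∘ₗ S = S ∘ₗ E) :
    F ∘ₗ (P ∘ₗ D - Q ∘ₗ D ∘ₗ S) = (P ∘ₗ D' - Q ∘ₗ D' ∘ₗ S) ∘ₗ E := by
  have hP' := fun y => LinearMap.congr_fun hP y
  have hQ' := fun y => LinearMap.congr_fun hQ y
  have hD' := fun y => LinearMap.congr_fun hD y
  have hS' := fun y => LinearMap.congr_fun hS y
  simp only [LinearMap.comp_apply] at hP' hQ' hD' hS'
  ext y
  simp [hP', hQ', hD', hS']

theorem map_blockMap_bosonComul {u : G} (hu : ∀ w : V, u • w = -w) {T : G → V ≃ₗ[ℂ] V}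
    (hTu : ∀ g, T (u * g) = T g) {B B' : symTensors V}
    (hT : ∀ g, TensorProduct.map (T g).toLinearMap (T g).toLinearMap
      (tensorDefect g (B : V ⊗[ℂ] V)) = tensorDefect g (B' : V ⊗[ℂ] V))
    (x : SuperGroupAlgebra G V) :
    TensorProduct.map (blockMap T).toLinearMap (blockMap T).toLinearMap (bosonComul u B x) =
      bosonComul u B' (blockMap T x) := by
  have hD : TensorProduct.map (blockMap T).toLinearMap (blockMap T).toLinearMap ∘ₗ
      (GradedTensorProduct.of ℂ (parity G V) (parity G V)).symm.toLinearMap ∘ₗ twistedComul B =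
      ((GradedTensorProduct.of ℂ (parity G V) (parity G V)).symm.toLinearMap ∘ₗ
        twistedComul B') ∘ₗ (blockMap T).toLinearMap :=
    LinearMap.ext fun y => congrArg (GradedTensorProduct.of ℂ (parity G V) (parity G V)).symm
      (blockTensorMap_twistedComul hT y)
  have hP (i : ZMod 2) : parityProj G V i ∘ₗ (blockMap T).toLinearMap =
      (blockMap T).toLinearMap ∘ₗ parityProj G V i :=
    LinearMap.ext fun y => parityProj_blockMap T i y
  have hu' : LinearMap.mulLeft ℂ (grp u) ∘ₗ (blockMap T).toLinearMap =
      (blockMap T).toLinearMap ∘ₗ LinearMap.mulLeft ℂ (grp u) :=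
    LinearMap.ext fun y => (blockMap_grp_mul hu hTu y).symm
  refine LinearMap.congr_fun (comp_sub_comp_comp_eq ?_ ?_ hD ?_) x
  · rw [← TensorProduct.map_comp, ← TensorProduct.map_comp, hP, LinearMap.comp_id,
      LinearMap.id_comp]
  · rw [← TensorProduct.map_comp, ← TensorProduct.map_comp, hP, hu']
  · rw [LinearMap.comp_sub, LinearMap.sub_comp, hP, hP]

end Intertwiners

/-! ### Symmetric tensors up to linear changes of coordinates -/

section Congruence

variable {V : Type v} [AddCommGroup V] [Module ℂ V]

/-- The bilinear form on the dual space given by a 2-tensor. -/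
def tensorForm (C : V ⊗[ℂ] V) : LinearMap.BilinForm ℂ (Module.Dual ℂ V) :=
  (TensorProduct.mk ℂ (Module.Dual ℂ V) (Module.Dual ℂ V)).compr₂
    ((TensorProduct.dualDistrib ℂ V V).flip C)

theorem tensorForm_apply (C : V ⊗[ℂ] V) (f h : Module.Dual ℂ V) :
    tensorForm C f h = TensorProduct.dualDistrib ℂ V V (f ⊗ₜ h) C := rfl

theorem tensorForm_isSymm {C : V ⊗[ℂ] V} (hC : C ∈ symTensors V) : (tensorForm C).IsSymm := by
  refine ⟨fun f h => ?_⟩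
  have hC' : TensorProduct.comm ℂ V V C = C := hC
  rw [tensorForm_apply, tensorForm_apply]
  conv_lhs => rw [← hC', TensorProduct.dualDistrib_apply_comm, TensorProduct.comm_tmul]

theorem repr_tensorProduct_eq_tensorForm {ι : Type*} (b : Module.Basis ι ℂ V) (C : V ⊗[ℂ] V)
    (i j : ι) : (b.tensorProduct b).repr C (i, j) = tensorForm C (b.coord i) (b.coord j) := by
  rw [tensorForm_apply]
  induction C using TensorProduct.induction_on with
  | zero => simp
  | add s t hs ht => rw [map_add, map_add, Finsupp.add_apply, hs, ht]
  | tmul x y =>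
    rw [Module.Basis.tensorProduct_repr_tmul_apply, TensorProduct.dualDistrib_apply]
    simp [mul_comm]

variable [FiniteDimensional ℂ V]

/-- Take the dual basis in the double dual and pull it back along evaluation. -/
theorem exists_basis_coord_eq {ι : Type*} [Finite ι] (v : Module.Basis ι ℂ (Module.Dual ℂ V)) :
    ∃ b : Module.Basis ι ℂ V, ∀ i, b.coord i = v i := by
  classical
  have := Fintype.ofFinite ι
  refine ⟨v.dualBasis.map (Module.evalEquiv ℂ V).symm, fun i => LinearMap.ext fun x => ?_⟩
  rw [Module.Basis.coord_apply, Module.Basis.map_repr, LinearEquiv.trans_apply,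
    LinearEquiv.symm_symm, Module.Basis.dualBasis_repr]
  rfl

/-- Every symmetric 2-tensor is a sum of squares of elements of some basis. -/
theorem exists_basis_eq_sum_sq (C : symTensors V) :
    ∃ (s : Finset (Fin (Module.finrank ℂ V))) (b : Module.Basis (Fin (Module.finrank ℂ V)) ℂ V),
      (C : V ⊗[ℂ] V) = ∑ i ∈ s, b i ⊗ₜ b i := by
  classical
  -- Diagonalize the form that `C` defines on the dual space; in the basis of `V` dual to an
  -- orthogonal one, `C` has no off-diagonal terms.
  obtain ⟨v₀, hv₀⟩ := LinearMap.BilinForm.exists_orthogonal_basis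
    (LinearMap.BilinForm.isSymm_iff.1 (tensorForm_isSymm C.2))
  obtain ⟨v, hv⟩ : ∃ v : Module.Basis (Fin (Module.finrank ℂ V)) ℂ (Module.Dual ℂ V),
      (tensorForm (C : V ⊗[ℂ] V)).IsOrthoᵢ v := by
    rw [← Subspace.dual_finrank_eq]
    exact ⟨v₀, hv₀⟩
  obtain ⟨b, hb⟩ := exists_basis_coord_eq v
  have hsum : (C : V ⊗[ℂ] V) = ∑ i, tensorForm (C : V ⊗[ℂ] V) (v i) (v i) • (b i ⊗ₜ b i) := by
    conv_lhs => rw [← (b.tensorProduct b).sum_repr (C : V ⊗[ℂ] V), Fintype.sum_prod_type]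
    refine Finset.sum_congr rfl fun i _ => ?_
    rw [Finset.sum_eq_single i]
    · rw [repr_tensorProduct_eq_tensorForm, hb, Module.Basis.tensorProduct_apply]
    · intro j _ hj
      rw [repr_tensorProduct_eq_tensorForm, hb, hb,
        (LinearMap.isOrthoᵢ_def.1 hv) i j hj.symm, zero_smul]
    · simp
  -- Square roots of the nonzero diagonal entries are absorbed into the basis. At zero entries the
  -- scale is set to `1`, only to keep it invertible.
  have hc (i : Fin (Module.finrank ℂ V)) : ∃ c : ℂˣ,
      tensorForm (C : V ⊗[ℂ] V) (v i) (v i) ≠ 0 →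
        (c : ℂ) ^ 2 = tensorForm (C : V ⊗[ℂ] V) (v i) (v i) := by
    by_cases h : tensorForm (C : V ⊗[ℂ] V) (v i) (v i) = 0
    · exact ⟨1, fun h' => absurd h h'⟩
    · obtain ⟨z, hz⟩ := IsAlgClosed.exists_pow_nat_eq
        (tensorForm (C : V ⊗[ℂ] V) (v i) (v i)) two_pos
      refine ⟨Units.mk0 z ?_, fun _ => hz⟩
      rintro rfl
      exact h (by rw [← hz]; norm_num)
  choose c hc using hc
  refine ⟨Finset.univ.filter fun i => tensorForm (C : V ⊗[ℂ] V) (v i) (v i) ≠ 0, b.unitsSMul c, ?_⟩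
  rw [Finset.sum_filter]
  conv_lhs => rw [hsum]
  refine Finset.sum_congr rfl fun i _ => ?_
  split_ifs with h
  · rw [Module.Basis.unitsSMul_apply, ← hc i h, Units.smul_def, TensorProduct.smul_tmul_smul, sq]
  · rw [not_not.1 h, zero_smul]

/-- The symmetric 2-tensors on `V` form finitely many orbits under `GL(V)`. -/
theorem exists_finite_congruence_invariant :
    ∃ (k : symTensors V → Finset (Fin (Module.finrank ℂ V)))
      (τ : symTensors V → symTensors V → V ≃ₗ[ℂ] V), ∀ C C', k C = k C' →
        TensorProduct.map (τ C C').toLinearMap (τ C C').toLinearMap (C : V ⊗[ℂ] V) = C' := by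
  choose k b hb using exists_basis_eq_sum_sq (V := V)
  -- The label of `C` is the set of basis indices in its sum of squares. When labels agree, matching
  -- the two adapted bases index by index carries one sum to the other.
  refine ⟨k, fun C C' => (b C).equiv (b C') (Equiv.refl _), fun C C' h => ?_⟩
  rw [hb C, hb C', map_sum, h]
  refine Finset.sum_congr rfl fun i _ => ?_
  rw [TensorProduct.map_tmul]
  simp

end Congruence

/-! ### The tensors `g B - B` and the finiteness argument. -/

section Finiteness

variable {G : Type u} {V : Type v} [Group G] [AddCommGroup V] [Module ℂ V]
  [DistribMulAction G V] [SMulCommClass G ℂ V]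

theorem tensorDefect_mem_symTensors (g : G) (B : symTensors V) :
    tensorDefect g (B : V ⊗[ℂ] V) ∈ symTensors V := by
  refine sub_mem ?_ B.2
  have h : TensorProduct.comm ℂ V V B = B := B.2
  change TensorProduct.comm ℂ V V (tensorAct g B) = tensorAct g B
  conv_rhs => rw [← h]
  exact (TensorProduct.map_comm _ _ _).symm

theorem tensorAct_mul_of_neg {u : G} (hu : ∀ w : V, u • w = -w) (g : G) (s : V ⊗[ℂ] V) :
    tensorAct (u * g) s = tensorAct g s := by
  induction s using TensorProduct.induction_on with
  | zero => simp
  | add s t hs ht => rw [map_add, map_add, hs, ht]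
  | tmul a b => simp [tensorAct, mul_smul, hu, TensorProduct.neg_tmul, TensorProduct.tmul_neg]

variable [Finite G]

/-- Here `blockMap T` is an isomorphism of coalgebras from parameter `B` to `B'`; its transpose goes
the other way, hence the order in the conclusion. -/
theorem dualIso_of_map_tensorDefect {u : G} (hu : ∀ w : V, u • w = -w) {T : G → V ≃ₗ[ℂ] V}
    (hTu : ∀ g, T (u * g) = T g) {B B' : symTensors V}
    (hT : ∀ g, TensorProduct.map (T g).toLinearMap (T g).toLinearMap
      (tensorDefect g (B : V ⊗[ℂ] V)) = tensorDefect g (B' : V ⊗[ℂ] V)) :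
    DualIso u B' B := by
  let E : Hopf G V u B ≃ₗ[ℂ] Hopf G V u B' := blockMap T
  have hE (x : Hopf G V u B) : TensorProduct.map E.toLinearMap E.toLinearMap
      (CoalgebraStruct.comul (R := ℂ) x) = CoalgebraStruct.comul (R := ℂ) (E x) :=
    map_blockMap_bosonComul hu hTu hT x
  refine ⟨WithConv.congrLinearEquiv E.dualMap, ?_, fun φ ψ => ?_⟩
  · exact congrArg WithConv.toConv (LinearMap.ext (superCounit_blockMap T))
  · refine congrArg WithConv.toConv (LinearMap.ext fun x => ?_)
    change LinearMap.mul' ℂ ℂ (TensorProduct.map φ.ofConv ψ.ofConv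
        (CoalgebraStruct.comul (R := ℂ) (E x))) =
      LinearMap.mul' ℂ ℂ (TensorProduct.map (φ.ofConv ∘ₗ E.toLinearMap) (ψ.ofConv ∘ₗ E.toLinearMap)
        (CoalgebraStruct.comul (R := ℂ) x))
    rw [← hE, TensorProduct.map_comp, LinearMap.comp_apply]

end Finiteness

end TriHopf

end

theorem corollary5p4 {G V : Type*} [Group G] [Finite G]
    [AddCommGroup V] [Module ℂ V] [FiniteDimensional ℂ V]
    [DistribMulAction G V] [SMulCommClass G ℂ V]
    (u : G) (hu_central : u ∈ Subgroup.center G) (hu_sq : u ^ 2 = 1)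
    (hu_V : ∀ w : V, u • w = -w) :
    Finite (Quotient (TriHopf.dualIsoSetoid V u)) := by
  obtain ⟨k, τ, hτ⟩ := TriHopf.exists_finite_congruence_invariant (V := V)
  let δ (B : TriHopf.symTensors V) (g : G) : TriHopf.symTensors V :=
    ⟨TriHopf.tensorDefect g (B : V ⊗[ℂ] V), TriHopf.tensorDefect_mem_symTensors g B⟩
  have hδ (B : TriHopf.symTensors V) (g : G) : δ B (u * g) = δ B g :=
    Subtype.ext (congrArg (· - (B : V ⊗[ℂ] V)) (TriHopf.tensorAct_mul_of_neg hu_V g B))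
  -- The labels of all `g B - B`, for a chosen representative `B`, form a point of a finite set of
  -- functions on `G`; equal labels must force equal classes.
  refine Finite.of_injective (fun (q : Quotient (TriHopf.dualIsoSetoid V u)) (g : G) =>
    k (δ q.out g)) fun q q' h => ?_
  rw [← q.out_eq, ← q'.out_eq]
  refine Quotient.sound (TriHopf.dualIso_of_map_tensorDefect hu_V
    (T := fun g => τ (δ q'.out g) (δ q.out g)) (fun g => ?_) fun g => ?_)
  -- The chosen automorphism depends only on the pair of tensors, which is the same for `u g` and
  -- `g`.
  · simp only [hδ]
  · exact hτ _ _ (congrFun h g).symm
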